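/- Let $\mathbb K\subset\mathbb C$ be a field, let $\mathbf f=(f_1,\dots,f_N)$ be a system of polynomials in $\mathbb K[x_1,\dots,x_n]$, and let $\xi\in\mathbb C^n$ be an isolated root of $\mathbf f$. *Multiplicity and nil-index.* Let $I=\langle \mathbf f\rangle\subset\mathbb C[\mathbf x]$ and let $Q$ be the primary component of $I$ at $\xi$. The multiplicity of $\xi$ is $\delta_\xi(\mathbf f)=\dim_{\mathbb C}\mathbb C[\mathbf x]/Q$, and $\xi$ is a simple root if it is a root with $\delta_\xi(\mathbf f)=1$. A polynomial $\Lambda=\sum_\beta a_\beta\,\partial^\beta\in\mathbb C[\partial_1,\dots,\partial_n]$ acts on $\mathbb C[\mathbf x]$ by $\Lambda(p)=\sum_\beta a_\beta\,(\partial^\beta p)(\xi)$. Let $\mathscr D=\{\Lambda : \Lambda(p)=0 \text{ for all } p\in I\}$, and let $\mathscr D_t$ be the set of elements of $\mathscr D$ of degree at most $t$ in $\partial_1,\dots,\partial_n$. The nil-index $o_\xi(\mathbf f)$ is the smallest $t\ge 0$ such that $\mathscr D_{t+1}=\mathscr D_t$. *Deflation of order $1$.* Let $\mathbf g=(g_1,\dots,g_M)$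 be a system of polynomials in $\mathbb K[\mathbf x]$ having $\xi$ as a root, with Jacobian matrix $J_{\mathbf g}(\mathbf x)=[\partial_j g_i(\mathbf x)]$. Let $r=\operatorname{rank} J_{\mathbf g}(\xi)$ and $c=n-r$. Reorder the rows and columns of $J_{\mathbf g}(\mathbf x)$ so that it takes the form $\begin{bmatrix}A&B\\C&D\end{bmatrix}$, where $A$ is an $r\times r$ block with $\det A(\xi)\ne 0$ and $B$ is $r\times c$. The $c$ columns of $$\det(A)\begin{bmatrix}-A^{-1}B\\ \mathrm{Id}\end{bmatrix}$$ (the identity matrix if $r=0$) have polynomial entries, and define operators $\Lambda_i^{\mathbf x}=\sum_{j=1}^n\lambda_{i,j}(\mathbf x)\,\partial_j$ for $i=1,\dots,c$. For a non-empty set $\bm i=\{i_1,\dots,i_m\}\subset\{1,\dots,c\}$, the $\bm i$-deflated system of order $1$ of $\mathbf g$ is $$\{\mathbf g,\ \Lambda_{i_1}^{\mathbf x}(\mathbf g),\dots,\Lambda_{i_m}^{\mathbf x}(\mathbf g)\}.$$ *Statement.* Put $\mathbf f^{(0)}=\mathbf f$. As long as $\operatorname{rank}J_{\mathbf f^{(k)}}(\xi)<n$,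 let $\mathbf f^{(k+1)}$ be an $\bm i_{k+1}$-deflated system of order $1$ of $\mathbf f^{(k)}$, for an arbitrary choice at each step of the block $A$ and of the non-empty set $\bm i_{k+1}$. Then, for any such choices, there exists $k\le o_\xi(\mathbf f)$ such that $\mathbf f^{(k)}$ is obtained by $k$ such deflations and $\xi$ is a simple root of $\mathbf f^{(k)}$. -/

import Mathlib

open MvPolynomial

noncomputable section

namespace Deflation

/- Throughout, `n` is the number of variables, `K` is a field embedded in `ℂ`, a polynomial system is
a family `f : ι → K[x₁, …, xₙ]`, and `ξ` is a point of `ℂⁿ`. -/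

/-! ### Roots, multiplicity, simple roots -/

/-- `ξ` is a root of the system `f`. -/
def IsRoot {n : ℕ} {K ι : Type*} [Field K] [Algebra K ℂ]
    (f : ι → MvPolynomial (Fin n) K) (ξ : Fin n → ℂ) : Prop :=
  ∀ j, aeval ξ (f j) = 0

/-- `ξ` is an isolated root of `f`: it is a root, and some Zariski open neighbourhood `{g ≠ 0}` of
`ξ` contains no other root in `ℂⁿ`. Equivalently, `{ξ}` is an irreducible component of the zero set
of `f` in `ℂⁿ`. -/
def IsIsolatedRoot {n : ℕ} {K ι : Type*} [Field K] [Algebra K ℂ]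
    (f : ι → MvPolynomial (Fin n) K) (ξ : Fin n → ℂ) : Prop :=
  IsRoot f ξ ∧ ∃ g : MvPolynomial (Fin n) ℂ, eval ξ g ≠ 0 ∧
    ∀ x : Fin n → ℂ, IsRoot f x → eval x g ≠ 0 → x = ξ

/-- The ideal `I` of `ℂ[x]` generated by the system `f`. -/
def systemIdeal {n : ℕ} {K ι : Type*} [Field K] [Algebra K ℂ]
    (f : ι → MvPolynomial (Fin n) K) : Ideal (MvPolynomial (Fin n) ℂ) :=
  Ideal.span (Set.range fun j => MvPolynomial.map (algebraMap K ℂ) (f j))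

/-- The maximal ideal `𝔪_ξ` of the polynomials that vanish at `ξ`. -/
abbrev pointIdeal {n : ℕ} (ξ : Fin n → ℂ) : Ideal (MvPolynomial (Fin n) ℂ) :=
  RingHom.ker (eval ξ)

instance pointIdeal_isPrime {n : ℕ} (ξ : Fin n → ℂ) : (pointIdeal ξ).IsPrime :=
  RingHom.ker_isPrime _

/-- The component `Q` of `I` at `ξ`: the contraction of the extension of `I` to the local ring
`ℂ[x]_{𝔪_ξ}`. When `ξ` is an isolated root this is the `𝔪_ξ`-primary component of `I`. -/
def primaryComponent {n : ℕ} (I : Ideal (MvPolynomial (Fin n) ℂ)) (ξ : Fin n → ℂ) :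
    Ideal (MvPolynomial (Fin n) ℂ) :=
  (I.map (algebraMap (MvPolynomial (Fin n) ℂ) (Localization.AtPrime (pointIdeal ξ)))).comap
    (algebraMap (MvPolynomial (Fin n) ℂ) (Localization.AtPrime (pointIdeal ξ)))

/-- The multiplicity `δ_ξ(f) = dim_ℂ ℂ[x]/Q`. -/
def multiplicity {n : ℕ} {K ι : Type*} [Field K] [Algebra K ℂ]
    (f : ι → MvPolynomial (Fin n) K) (ξ : Fin n → ℂ) : ℕ :=
  Module.finrank ℂ (MvPolynomial (Fin n) ℂ ⧸ primaryComponent (systemIdeal f) ξ)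

/-- A simple root is a root of multiplicity one. -/
def IsSimpleRoot {n : ℕ} {K ι : Type*} [Field K] [Algebra K ℂ]
    (f : ι → MvPolynomial (Fin n) K) (ξ : Fin n → ℂ) : Prop :=
  IsRoot f ξ ∧ multiplicity f ξ = 1

/-! ### The inverse system and the nil-index -/

/-- The differential operator `∂^β = ∂₁^{β₁} ⋯ ∂ₙ^{βₙ}` on `ℂ[x]`. -/
def iteratedPartial {n : ℕ} (β : Fin n →₀ ℕ) : Module.End ℂ (MvPolynomial (Fin n) ℂ) :=
  (List.ofFn fun i : Fin n =>
    ((pderiv i : Derivation ℂ (MvPolynomial (Fin n) ℂ) (MvPolynomial (Fin n) ℂ)) :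
      Module.End ℂ (MvPolynomial (Fin n) ℂ)) ^ β i).prod

/-- A polynomial `Λ = ∑ a_β ∂^β` in the variables `∂₁, …, ∂ₙ` is sent to the linear functional
`p ↦ ∑ a_β (∂^β p)(ξ)` on `ℂ[x]`. -/
def diffFunctional {n : ℕ} (ξ : Fin n → ℂ) :
    MvPolynomial (Fin n) ℂ →ₗ[ℂ] Module.Dual ℂ (MvPolynomial (Fin n) ℂ) :=
  (basisMonomials (Fin n) ℂ).constr ℂ fun β =>
    (aeval ξ : MvPolynomial (Fin n) ℂ →ₐ[ℂ] ℂ).toLinearMap ∘ₗ iteratedPartial β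

/-- The inverse system `𝒟 = I^⊥ ∩ ℂ[∂_ξ]`: the `Λ ∈ ℂ[∂]` with `Λ(p) = 0` for all `p ∈ I`. -/
def inverseSystem {n : ℕ} (I : Ideal (MvPolynomial (Fin n) ℂ)) (ξ : Fin n → ℂ) :
    Submodule ℂ (MvPolynomial (Fin n) ℂ) :=
  (I.restrictScalars ℂ).dualAnnihilator.comap (diffFunctional ξ)

/-- `𝒟_t`: the elements of `𝒟` of order (total degree in `∂₁, …, ∂ₙ`) at most `t`. -/
def inverseSystemLE {n : ℕ} (I : Ideal (MvPolynomial (Fin n) ℂ)) (ξ : Fin n → ℂ) (t : ℕ) :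
    Submodule ℂ (MvPolynomial (Fin n) ℂ) :=
  inverseSystem I ξ ⊓ restrictTotalDegree (Fin n) ℂ t

/-- The nil-index `o_ξ(f)`: the smallest `t ≥ 0` with `𝒟_{t+1} = 𝒟_t`. -/
def nilIndex {n : ℕ} {K ι : Type*} [Field K] [Algebra K ℂ]
    (f : ι → MvPolynomial (Fin n) K) (ξ : Fin n → ℂ) : ℕ :=
  sInf {t : ℕ | inverseSystemLE (systemIdeal f) ξ (t + 1) = inverseSystemLE (systemIdeal f) ξ t}

/-! ### The `𝐢`-deflated system of order one -/

/-- The Jacobian matrix `J_f(x) = [∂_j f_i(x)]`, with polynomial entries. -/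
def jacobian {n : ℕ} {K ι : Type*} [Field K] (f : ι → MvPolynomial (Fin n) K) :
    Matrix ι (Fin n) (MvPolynomial (Fin n) K) :=
  Matrix.of fun i j => pderiv j (f i)

/-- The Jacobian matrix `J_f(ξ)` at the point `ξ`. -/
def jacobianAt {n : ℕ} {K ι : Type*} [Field K] [Algebra K ℂ]
    (f : ι → MvPolynomial (Fin n) K) (ξ : Fin n → ℂ) : Matrix ι (Fin n) ℂ :=
  (jacobian f).map (aeval ξ)

/-- A way of bringing `J_f` into the block form `[A B; C D]` by reordering rows and columns, where
`A` is an `r × r` block, `r = rank J_f(ξ) = rank A(ξ)`, and `c = n - r`: `row` picks the rows of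
`[A B]`, and `col` splits the columns into the `r` columns of `A` and the `c` columns of `B`. -/
structure BlockForm {n : ℕ} {K ι : Type*} [Field K] [Algebra K ℂ]
    (f : ι → MvPolynomial (Fin n) K) (ξ : Fin n → ℂ) where
  r : ℕ
  c : ℕ
  rank_eq : (jacobianAt f ξ).rank = r
  row : Fin r ↪ ι
  col : Fin r ⊕ Fin c ≃ Fin n
  det_ne_zero : ((jacobianAt f ξ).submatrix row fun k => col (Sum.inl k)).det ≠ 0

namespace BlockForm

variable {n : ℕ} {K ι : Type*} [Field K] [Algebra K ℂ]
  {f : ι → MvPolynomial (Fin n) K} {ξ : Fin n → ℂ}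

/-- The block `A(x)`. -/
def A (S : BlockForm f ξ) : Matrix (Fin S.r) (Fin S.r) (MvPolynomial (Fin n) K) :=
  (jacobian f).submatrix S.row fun k => S.col (Sum.inl k)

/-- The block `B(x)`. -/
def B (S : BlockForm f ξ) : Matrix (Fin S.r) (Fin S.c) (MvPolynomial (Fin n) K) :=
  (jacobian f).submatrix S.row fun l => S.col (Sum.inr l)

/-- The coefficients `λ_{i,j}(x)`: column `i` of `det A · [-A⁻¹ B; Id]`, where the polynomial matrix
`det A · A⁻¹` is the adjugate of `A`. -/
def coeff (S : BlockForm f ξ) (i : Fin S.c) (j : Fin n) : MvPolynomial (Fin n) K :=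
  Sum.elim (fun k => -(S.A.adjugate * S.B) k i) (fun l => if l = i then S.A.det else 0)
    (S.col.symm j)

/-- The operator `Λ_i^x = ∑_j λ_{i,j}(x) ∂_j`. -/
def op (S : BlockForm f ξ) (i : Fin S.c) (p : MvPolynomial (Fin n) K) : MvPolynomial (Fin n) K :=
  ∑ j, S.coeff i j * pderiv j p

end BlockForm

/-- `g` is an `𝐢`-deflated system of order one of `f` at `ξ`: for some block form of the Jacobian and
some non-empty `𝐢 ⊆ {1, …, c}`, the system `g` lists, in some order, the polynomials `f_j` and the
polynomials `Λ_i^x(f_j)` with `i ∈ 𝐢`. -/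
def IsDeflatedSystem {n : ℕ} {K ι κ : Type*} [Field K] [Algebra K ℂ] (ξ : Fin n → ℂ)
    (f : ι → MvPolynomial (Fin n) K) (g : κ → MvPolynomial (Fin n) K) : Prop :=
  ∃ (S : BlockForm f ξ) (s : Finset (Fin S.c)), s.Nonempty ∧
    ∃ e : κ ≃ ι ⊕ (s × ι), ∀ k, g k = Sum.elim f (fun q => S.op q.1 (f q.2)) (e k)

/-- `F 0, F 1, …` is a sequence of successive deflations at `ξ` (`F k` has `N k` equations): as long
as `J_{F k}(ξ)` has rank `< n`, i.e. as long as a non-empty index set can be chosen, `F (k + 1)` is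
an `𝐢`-deflated system of `F k`, for arbitrary choices of the block form and of `𝐢` at each step.
Nothing is required of the later systems once the Jacobian has rank `n`. -/
def IsDeflationSequence {n : ℕ} {K : Type*} [Field K] [Algebra K ℂ] (ξ : Fin n → ℂ)
    (N : ℕ → ℕ) (F : (k : ℕ) → Fin (N k) → MvPolynomial (Fin n) K) : Prop :=
  ∀ k, (jacobianAt (F k) ξ).rank < n → IsDeflatedSystem ξ (F k) (F (k + 1))

end Deflation

end

namespace Deflation

open Finsupp (single degree)

variable {n : ℕ}

/-! Each deflation raises the order of a functional by one, and the nil-index bounds that order. A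
functional on `ℂ[x]` comes from some `Λ` of degree at most `t` exactly when it kills `𝔪_ξ ^ (t +
1)`, so the inverse system can be studied through powers of `𝔪_ξ`.

Let `g` be a deflation of `f` by `D = Λ_i^x`. The Leibniz rule gives `D(I_f) ⊆ I_g`. Hence if `φ`
kills `I_g`, then `φ ∘ D` kills `I_f`; since `D` does not vanish at `ξ`, composing with it raises
the order by exactly one (`apply_eq_zero_of_comp_derivation`, `IsDeflatedSystem.exists_order_succ`).
Deflation keeps `ξ` a root, because the value of `D` at `ξ` lies in `ker J_f(ξ)`. Pulling evaluation
at `ξ` back through `k` deflations therefore gives an element of order exactly `k` in the inverse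
system of the original `f`.

At an isolated root the orders are bounded by the nil-index (`IsIsolatedRoot.apply_eq_zero`), so the
Jacobian reaches rank `n` within that many steps. Nakayama's lemma then makes the root simple
(`isSimpleRoot_of_rank`). -/

/-! ### Translation to the origin -/

/-- The automorphism `p(x) ↦ p(x + ξ)` of `ℂ[x]`. -/
noncomputable def translate (ξ : Fin n → ℂ) :
    MvPolynomial (Fin n) ℂ ≃ₐ[ℂ] MvPolynomial (Fin n) ℂ :=
  AlgEquiv.ofAlgHom (aeval fun i => X i + C (ξ i)) (aeval fun i => X i - C (ξ i))
    (by ext i; simp [← algebraMap_eq]) (by ext i; simp [← algebraMap_eq])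

lemma translate_X (ξ : Fin n → ℂ) (i : Fin n) : translate ξ (X i) = X i + C (ξ i) := by
  simp [translate]

lemma constantCoeff_translate (ξ : Fin n → ℂ) (p : MvPolynomial (Fin n) ℂ) :
    constantCoeff (translate ξ p) = eval ξ p := by
  have h : (constantCoeff.comp (translate ξ : MvPolynomial (Fin n) ℂ →+* MvPolynomial (Fin n) ℂ))
      = eval ξ := by
    ext i
    · simp [translate]
    · simp [translate_X]
  exact congr($h p)

lemma translate_pderiv (ξ : Fin n → ℂ) (i : Fin n) (p : MvPolynomial (Fin n) ℂ) :
    translate ξ (pderiv i p) = pderiv i (translate ξ p) := by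
  induction p using MvPolynomial.induction_on with
  | C a =>
    have h : translate ξ (C a) = C a := (translate ξ).commutes a
    rw [h, pderiv_C, map_zero]
  | add p q hp hq => simp [hp, hq]
  | mul_X p j hp =>
    simp only [Derivation.leibniz, smul_eq_mul, map_add, map_mul, hp, translate_X, pderiv_C,
      add_zero, pderiv_X, Pi.single_apply]
    split_ifs <;> simp

lemma pointIdeal_eq_comap (ξ : Fin n → ℂ) :
    pointIdeal ξ = (idealOfVars (Fin n) ℂ).comap (translate ξ) := by
  ext p
  have := mem_pow_idealOfVars_iff' 1 (translate ξ p)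
  rw [pow_one] at this
  rw [RingHom.mem_ker, Ideal.mem_comap, this, ← constantCoeff_translate, constantCoeff_eq]
  simp [Finsupp.degree_eq_zero_iff]

lemma mem_comap_pow_of_equiv {R S : Type*} [CommRing R] [CommRing S] (e : R ≃+* S) (I : Ideal S)
    (t : ℕ) (p : R) : p ∈ I.comap e ^ t ↔ e p ∈ I ^ t := by
  rw [← Ideal.map_symm, ← Ideal.map_pow, Ideal.map_symm, Ideal.mem_comap]

lemma mem_pointIdeal_pow (ξ : Fin n → ℂ) (t : ℕ) (p : MvPolynomial (Fin n) ℂ) :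
    p ∈ pointIdeal ξ ^ t ↔ ∀ β, degree β < t → coeff β (translate ξ p) = 0 := by
  rw [← mem_pow_idealOfVars_iff', pointIdeal_eq_comap]
  exact mem_comap_pow_of_equiv (translate ξ).toRingEquiv _ t p

/-! ### Functionals given by differential operators -/

/-- The scalar is `(γ i + b)! / (γ i)!`; only its non-vanishing, a characteristic zero fact, is
used. -/
lemma coeff_pderiv_pow (i : Fin n) (b : ℕ) (γ : Fin n →₀ ℕ) :
    ∃ c : ℂ, c ≠ 0 ∧ ∀ p : MvPolynomial (Fin n) ℂ,
      coeff γ ((((pderiv i : Derivation ℂ (MvPolynomial (Fin n) ℂ) (MvPolynomial (Fin n) ℂ)) :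
        Module.End ℂ (MvPolynomial (Fin n) ℂ)) ^ b) p) = c * coeff (γ + single i b) p := by
  induction b generalizing γ with
  | zero => exact ⟨1, one_ne_zero, by simp⟩
  | succ b ih =>
    obtain ⟨c, hc, h⟩ := ih (γ + single i 1)
    refine ⟨(γ i + 1) * c, mul_ne_zero (Nat.cast_add_one_ne_zero _) hc, fun p => ?_⟩
    rw [pow_succ', Module.End.mul_apply]
    change coeff γ (pderiv i _) = _
    rw [coeff_pderiv, h, add_assoc, ← Finsupp.single_add, add_comm 1 b]
    ring

lemma coeff_list_prod_pderiv (β : Fin n →₀ ℕ) (l : List (Fin n)) (γ : Fin n →₀ ℕ) :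
    ∃ c : ℂ, c ≠ 0 ∧ ∀ p : MvPolynomial (Fin n) ℂ,
      coeff γ ((l.map fun i =>
        ((pderiv i : Derivation ℂ (MvPolynomial (Fin n) ℂ) (MvPolynomial (Fin n) ℂ)) :
          Module.End ℂ (MvPolynomial (Fin n) ℂ)) ^ β i).prod p)
        = c * coeff (γ + (l.map fun i => single i (β i)).sum) p := by
  induction l generalizing γ with
  | nil => exact ⟨1, one_ne_zero, by simp⟩
  | cons i l ih =>
    obtain ⟨c₁, hc₁, h₁⟩ := coeff_pderiv_pow i (β i) γ
    obtain ⟨c₂, hc₂, h₂⟩ := ih (γ + single i (β i))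
    refine ⟨c₁ * c₂, mul_ne_zero hc₁ hc₂, fun p => ?_⟩
    rw [List.map_cons, List.prod_cons, Module.End.mul_apply, h₁, h₂, List.map_cons, List.sum_cons,
      add_assoc, mul_assoc]

lemma constantCoeff_iteratedPartial (β : Fin n →₀ ℕ) :
    ∃ c : ℂ, c ≠ 0 ∧ ∀ p : MvPolynomial (Fin n) ℂ,
      constantCoeff (iteratedPartial β p) = c * coeff β p := by
  obtain ⟨c, hc, h⟩ := coeff_list_prod_pderiv β (List.finRange n) 0
  refine ⟨c, hc, fun p => ?_⟩
  have hβ : ((List.finRange n).map fun i => single i (β i)).sum = β := by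
    rw [← List.ofFn_eq_map, List.sum_ofFn]
    exact Finsupp.univ_sum_single β
  rw [iteratedPartial, List.ofFn_eq_map, constantCoeff_eq, h, hβ, zero_add]

lemma translate_iteratedPartial (ξ : Fin n → ℂ) (β : Fin n →₀ ℕ) (p : MvPolynomial (Fin n) ℂ) :
    translate ξ (iteratedPartial β p) = iteratedPartial β (translate ξ p) := by
  have hpow : ∀ (i : Fin n) (b : ℕ), Commute
      ((translate ξ).toLinearMap : Module.End ℂ (MvPolynomial (Fin n) ℂ)) (((pderiv i : Derivation ℂ (MvPolynomial (Fin n) ℂ) (MvPolynomial (Fin n) ℂ)) :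
        Module.End ℂ (MvPolynomial (Fin n) ℂ)) ^ b) := fun i b =>
    Commute.pow_right (LinearMap.ext fun q => translate_pderiv ξ i q) b
  have : Commute ((translate ξ).toLinearMap : Module.End ℂ (MvPolynomial (Fin n) ℂ))
      (iteratedPartial β) := by
    refine Commute.list_prod_right _ _ fun x hx => ?_
    obtain ⟨i, rfl⟩ := (List.mem_ofFn' _ _).1 hx
    exact hpow i _
  exact congr($this.eq p)

/-- Up to non-zero scalars, `∂^β` at `ξ` is the dual basis of the monomials in `x - ξ`. -/
lemma exists_diffFunctional_apply (ξ : Fin n → ℂ) :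
    ∃ c : (Fin n →₀ ℕ) → ℂ, (∀ β, c β ≠ 0) ∧ ∀ Λ p : MvPolynomial (Fin n) ℂ,
      diffFunctional ξ Λ p = ∑ β ∈ Λ.support, coeff β Λ * (c β * coeff β (translate ξ p)) := by
  choose c hc h using constantCoeff_iteratedPartial (n := n)
  refine ⟨c, hc, fun Λ p => ?_⟩
  rw [diffFunctional, Module.Basis.constr_apply, Finsupp.sum, LinearMap.sum_apply]
  refine Finset.sum_congr rfl fun β _ => ?_
  rw [← h, ← translate_iteratedPartial, constantCoeff_translate]
  simp only [LinearMap.smul_apply, LinearMap.comp_apply, AlgHom.toLinearMap_apply, smul_eq_mul]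
  rfl

lemma diffFunctional_eq_zero_of_mem_pow {ξ : Fin n → ℂ} {t : ℕ} {Λ p : MvPolynomial (Fin n) ℂ}
    (hΛ : Λ.totalDegree ≤ t) (hp : p ∈ pointIdeal ξ ^ (t + 1)) : diffFunctional ξ Λ p = 0 := by
  obtain ⟨c, -, h⟩ := exists_diffFunctional_apply ξ
  rw [h]
  refine Finset.sum_eq_zero fun β hβ => ?_
  have hb : degree β ≤ t := (le_totalDegree hβ).trans hΛ
  simp [(mem_pointIdeal_pow ξ _ p).1 hp β (Nat.lt_succ_of_le hb)]

lemma translate_symm_monomial_mem_pow (ξ : Fin n → ℂ) {t : ℕ} {β : Fin n →₀ ℕ}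
    (h : t ≤ degree β) : (translate ξ).symm (monomial β 1) ∈ pointIdeal ξ ^ t := by
  rw [mem_pointIdeal_pow]
  intro γ hγ
  rw [AlgEquiv.apply_symm_apply, coeff_monomial, if_neg]
  rintro rfl
  omega

lemma exists_diffFunctional_translate_symm_monomial (ξ : Fin n → ℂ) :
    ∃ c : (Fin n →₀ ℕ) → ℂ, (∀ β, c β ≠ 0) ∧ ∀ (Λ : MvPolynomial (Fin n) ℂ) β,
      diffFunctional ξ Λ ((translate ξ).symm (monomial β 1)) = coeff β Λ * c β := by
  obtain ⟨c, hc, h⟩ := exists_diffFunctional_apply ξ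
  refine ⟨c, hc, fun Λ β => ?_⟩
  rw [h, AlgEquiv.apply_symm_apply]
  by_cases hβ : β ∈ Λ.support
  · refine (Finset.sum_eq_single β (fun γ _ hγ => ?_) fun h => absurd hβ h).trans ?_
    · simp [coeff_monomial, hγ.symm]
    · simp [coeff_monomial]
  · rw [notMem_support_iff.1 hβ, zero_mul]
    refine Finset.sum_eq_zero fun γ hγ => ?_
    rw [coeff_monomial, if_neg (by rintro rfl; exact hβ hγ), mul_zero, mul_zero]

lemma totalDegree_le_of_diffFunctional {ξ : Fin n → ℂ} {t : ℕ} {Λ : MvPolynomial (Fin n) ℂ}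
    (h : ∀ p ∈ pointIdeal ξ ^ (t + 1), diffFunctional ξ Λ p = 0) : Λ.totalDegree ≤ t := by
  obtain ⟨c, hc, hΛ⟩ := exists_diffFunctional_translate_symm_monomial ξ
  refine Finset.sup_le fun β hβ => ?_
  by_contra hlt
  have h0 := h _ (translate_symm_monomial_mem_pow ξ (Nat.succ_le_of_lt (not_le.1 hlt)))
  rw [hΛ] at h0
  exact mul_ne_zero (mem_support_iff.1 hβ) (hc β) h0

/-- The monomials in `x - ξ` of degree above `t` lie in `𝔪_ξ ^ (t + 1)`, so `φ` is determined by its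
finitely many values on the others, and these prescribe the coefficients of `Λ`. -/
lemma exists_eq_diffFunctional {ξ : Fin n → ℂ} {t : ℕ}
    {φ : Module.Dual ℂ (MvPolynomial (Fin n) ℂ)} (hφ : ∀ p ∈ pointIdeal ξ ^ (t + 1), φ p = 0) :
    ∃ Λ : MvPolynomial (Fin n) ℂ, diffFunctional ξ Λ = φ := by
  obtain ⟨c, hc, hΛ⟩ := exists_diffFunctional_translate_symm_monomial ξ
  have hfin : {β : Fin n →₀ ℕ | degree β ≤ t}.Finite := Finsupp.finite_of_degree_le t
  let Λ : MvPolynomial (Fin n) ℂ := ∑ β ∈ hfin.toFinset,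
    monomial β (φ ((translate ξ).symm (monomial β 1)) / c β)
  have hcoeff : ∀ β, coeff β Λ = if degree β ≤ t then
      φ ((translate ξ).symm (monomial β 1)) / c β else 0 := by
    intro β
    simp [Λ, coeff_sum, coeff_monomial]
  refine ⟨Λ, ?_⟩
  suffices (diffFunctional ξ Λ) ∘ₗ (translate ξ).symm.toLinearMap
      = φ ∘ₗ (translate ξ).symm.toLinearMap by
    refine LinearMap.ext fun p => ?_
    simpa using congr($this (translate ξ p))
  refine (basisMonomials (Fin n) ℂ).ext fun β => ?_
  simp only [coe_basisMonomials, LinearMap.comp_apply, AlgEquiv.toLinearMap_apply, hΛ, hcoeff]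
  split_ifs with hβ
  · exact div_mul_cancel₀ _ (hc β)
  · rw [hφ _ (translate_symm_monomial_mem_pow ξ (by omega)), zero_mul]

variable {K ι κ : Type*} [Field K] [Algebra K ℂ]

/-! ### The order filtration of the inverse system -/

lemma inverseSystemLE_succ_eq_iff (I : Ideal (MvPolynomial (Fin n) ℂ)) (ξ : Fin n → ℂ) (t : ℕ) :
    inverseSystemLE I ξ (t + 1) = inverseSystemLE I ξ t ↔
      ∀ φ : Module.Dual ℂ (MvPolynomial (Fin n) ℂ), (∀ p ∈ I, φ p = 0) →
        (∀ p ∈ pointIdeal ξ ^ (t + 2), φ p = 0) → ∀ p ∈ pointIdeal ξ ^ (t + 1), φ p = 0 := by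
  have hmem : ∀ (s : ℕ) (Λ : MvPolynomial (Fin n) ℂ), Λ ∈ inverseSystemLE I ξ s ↔
      (∀ p ∈ I, diffFunctional ξ Λ p = 0) ∧ Λ.totalDegree ≤ s := fun s Λ => by
    rw [inverseSystemLE, Submodule.mem_inf, mem_restrictTotalDegree, inverseSystem,
      Submodule.mem_comap, Submodule.mem_dualAnnihilator]
    rfl
  constructor
  · intro h φ hI hφ p hp
    obtain ⟨Λ, rfl⟩ := exists_eq_diffFunctional hφ
    have hΛ : Λ ∈ inverseSystemLE I ξ (t + 1) :=
      (hmem _ _).2 ⟨hI, totalDegree_le_of_diffFunctional hφ⟩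
    rw [h, hmem] at hΛ
    exact diffFunctional_eq_zero_of_mem_pow hΛ.2 hp
  · intro h
    refine SetLike.ext fun Λ => ?_
    rw [hmem, hmem]
    refine ⟨fun hΛ => ⟨hΛ.1, totalDegree_le_of_diffFunctional (h _ hΛ.1 fun p hp =>
      diffFunctional_eq_zero_of_mem_pow hΛ.2 hp)⟩, fun hΛ => ⟨hΛ.1, hΛ.2.trans t.le_succ⟩⟩

/-- For `y ∈ 𝔪_ξ`, the functional `q ↦ φ (y * q)` still kills `I` and has order one less than the
bound for `φ`. Stability at `t` applies to it, and products `y * q` span the next power of `𝔪_ξ`. -/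
lemma inverseSystemLE_succ_eq_succ {I : Ideal (MvPolynomial (Fin n) ℂ)} {ξ : Fin n → ℂ} {t : ℕ}
    (h : inverseSystemLE I ξ (t + 1) = inverseSystemLE I ξ t) :
    inverseSystemLE I ξ (t + 2) = inverseSystemLE I ξ (t + 1) := by
  rw [inverseSystemLE_succ_eq_iff] at h ⊢
  intro φ hI hφ p hp
  rw [pow_succ'] at hp
  refine Submodule.mul_induction_on hp (fun y hy q hq => ?_) fun a b ha hb => by
    rw [map_add, ha, hb, add_zero]
  refine h (φ ∘ₗ LinearMap.mulLeft ℂ y) (fun p hp => hI _ (I.mul_mem_left y hp))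
    (fun p hp => hφ _ ?_) q hq
  rw [pow_succ']
  exact Ideal.mul_mem_mul hy hp

lemma inverseSystemLE_succ_eq_of_le {I : Ideal (MvPolynomial (Fin n) ℂ)} {ξ : Fin n → ℂ}
    {s t : ℕ} (h : inverseSystemLE I ξ (t + 1) = inverseSystemLE I ξ t) (hst : t ≤ s) :
    inverseSystemLE I ξ (s + 1) = inverseSystemLE I ξ s := by
  induction s, hst using Nat.le_induction with
  | base => exact h
  | succ s _ ih => exact inverseSystemLE_succ_eq_succ ih

/-! ### Isolated roots -/

lemma pointIdeal_isMaximal (ξ : Fin n → ℂ) : (pointIdeal ξ).IsMaximal :=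
  RingHom.ker_isMaximal_of_surjective _ fun a => ⟨C a, eval_C a⟩

lemma exists_mul_sub_one_mem_pow {ξ : Fin n → ℂ} {g : MvPolynomial (Fin n) ℂ}
    (hg : g ∉ pointIdeal ξ) (d : ℕ) : ∃ h, h * g - 1 ∈ pointIdeal ξ ^ d := by
  have h1 : Ideal.span {g} ⊔ pointIdeal ξ = ⊤ := by
    rw [sup_comm]
    refine (pointIdeal_isMaximal ξ).1.2 _ (left_lt_sup.2 fun h => hg (h ?_))
    exact Ideal.mem_span_singleton_self g
  have h2 := (Ideal.eq_top_iff_one _).1 (Ideal.sup_pow_eq_top (n := d) h1)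
  obtain ⟨a, ha, b, hb, hab⟩ := Submodule.mem_sup.1 h2
  obtain ⟨h, rfl⟩ := Ideal.mem_span_singleton'.1 ha
  exact ⟨h, by rw [← hab, sub_add_cancel_left]; exact neg_mem hb⟩

lemma aeval_eq_eval_map (x : Fin n → ℂ) (p : MvPolynomial (Fin n) K) :
    aeval x p = eval x (map (algebraMap K ℂ) p) := by
  rw [eval_map, aeval_def]

lemma isRoot_iff_systemIdeal_le {f : ι → MvPolynomial (Fin n) K} {ξ : Fin n → ℂ} :
    IsRoot f ξ ↔ systemIdeal f ≤ pointIdeal ξ := by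
  rw [systemIdeal, Ideal.span_le, Set.range_subset_iff]
  simp only [IsRoot, aeval_eq_eval_map]
  rfl

/-- By the Nullstellensatz: if `g` isolates `ξ`, every element of `g * 𝔪_ξ` vanishes on the zero set
of the system, and some power of this ideal lies in `I`. -/
lemma IsIsolatedRoot.exists_pow_mul_mem {f : ι → MvPolynomial (Fin n) K} {ξ : Fin n → ℂ}
    (h : IsIsolatedRoot f ξ) : ∃ g ∉ pointIdeal ξ, ∃ N : ℕ,
      ∀ q ∈ pointIdeal ξ ^ N, g * q ∈ systemIdeal f := by
  obtain ⟨-, g, hg, hx⟩ := h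
  have hrad : Ideal.span {g} * pointIdeal ξ ≤ (systemIdeal f).radical := by
    rw [← vanishingIdeal_zeroLocus_eq_radical (K := ℂ), Ideal.span_singleton_mul_le_iff]
    intro y hy x hxI
    by_cases hgx : eval x g = 0
    · simp [hgx]
    · have : IsRoot f x := isRoot_iff_systemIdeal_le.2 fun p hp => by
        simpa [coe_aeval_eq_eval] using hxI p hp
      rw [hx x this hgx]
      have hy' : eval ξ y = 0 := hy
      simp [hy']
  obtain ⟨N, hN⟩ := Ideal.exists_pow_le_of_le_radical_of_fg hrad (IsNoetherian.noetherian _)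
  rw [mul_pow, Ideal.span_singleton_pow, Ideal.span_singleton_mul_le_iff] at hN
  refine ⟨g ^ N, fun hm => hg ((pointIdeal_isPrime ξ).mem_of_pow_mem N hm), N, hN⟩

lemma IsIsolatedRoot.inverseSystemLE_nilIndex {f : ι → MvPolynomial (Fin n) K} {ξ : Fin n → ℂ}
    (h : IsIsolatedRoot f ξ) :
    inverseSystemLE (systemIdeal f) ξ (nilIndex f ξ + 1)
      = inverseSystemLE (systemIdeal f) ξ (nilIndex f ξ) := by
  obtain ⟨g, hg, N, hN⟩ := h.exists_pow_mul_mem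
  -- The set must be shown non-empty: otherwise `sInf` would return the default `0`.
  refine Nat.sInf_mem (s := {t | inverseSystemLE (systemIdeal f) ξ (t + 1)
    = inverseSystemLE (systemIdeal f) ξ t}) ⟨N, ?_⟩
  refine (inverseSystemLE_succ_eq_iff _ _ _).2 fun φ hI hφ p hp => ?_
  obtain ⟨u, hu⟩ := exists_mul_sub_one_mem_pow hg (N + 2)
  -- Since `u` inverts `g` modulo `𝔪_ξ ^ (N + 2)`, the first term lies in `I` and the second in `𝔪_ξ
  -- ^ (N + 2)`; `φ` kills both.
  have hp' : p = u * (g * p) - p * (u * g - 1) := by ring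
  rw [hp', map_sub, hI _ (Ideal.mul_mem_left _ _ (hN p (Ideal.pow_le_pow_right N.le_succ hp))),
    hφ _ (Ideal.mul_mem_left _ _ hu), sub_zero]

/-- A functional that vanishes on the ideal of an isolated root and has finite order has order at
most the nil-index. -/
lemma IsIsolatedRoot.apply_eq_zero {f : ι → MvPolynomial (Fin n) K} {ξ : Fin n → ℂ}
    (h : IsIsolatedRoot f ξ) {t : ℕ} (ht : nilIndex f ξ < t)
    {φ : Module.Dual ℂ (MvPolynomial (Fin n) ℂ)} (hI : ∀ p ∈ systemIdeal f, φ p = 0)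
    (hφ : ∀ p ∈ pointIdeal ξ ^ (t + 1), φ p = 0) : ∀ p ∈ pointIdeal ξ ^ t, φ p = 0 := by
  obtain ⟨s, rfl⟩ := Nat.exists_eq_add_of_lt ht
  exact (inverseSystemLE_succ_eq_iff _ _ _).1 (inverseSystemLE_succ_eq_of_le
    h.inverseSystemLE_nilIndex (Nat.le_add_right _ s)) φ hI hφ

/-! ### Roots with a Jacobian of full rank -/

lemma coeff_single_translate (ξ : Fin n → ℂ) (i : Fin n) (p : MvPolynomial (Fin n) ℂ) :
    coeff (Finsupp.single i 1) (translate ξ p) = eval ξ (pderiv i p) := by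
  rw [← constantCoeff_translate, translate_pderiv, constantCoeff_eq, coeff_pderiv]
  simp

lemma mem_pointIdeal_sq {ξ : Fin n → ℂ} {p : MvPolynomial (Fin n) ℂ} (h : eval ξ p = 0)
    (h' : ∀ i, eval ξ (pderiv i p) = 0) : p ∈ pointIdeal ξ ^ 2 := by
  rw [mem_pointIdeal_pow]
  intro β hβ
  obtain hβ | hβ : β.degree = 0 ∨ β.degree = 1 := by omega
  · rw [(Finsupp.degree_eq_zero_iff β).1 hβ, ← constantCoeff_eq, constantCoeff_translate, h]
  · obtain ⟨i, rfl⟩ := Finsupp.range_single_one.ge hβ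
    rw [coeff_single_translate, h']

lemma jacobianAt_apply (f : ι → MvPolynomial (Fin n) K) (ξ : Fin n → ℂ) (i : ι) (j : Fin n) :
    jacobianAt f ξ i j = eval ξ (pderiv j (map (algebraMap K ℂ) (f i))) := by
  rw [pderiv_map, ← aeval_eq_eval_map]
  rfl

lemma pointIdeal_le_sup_sq {m : ℕ} {f : Fin m → MvPolynomial (Fin n) K} {ξ : Fin n → ℂ}
    (hroot : IsRoot f ξ) (hrank : n ≤ (jacobianAt f ξ).rank) :
    pointIdeal ξ ≤ systemIdeal f ⊔ pointIdeal ξ ^ 2 := by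
  have hspan : (⊤ : Submodule ℂ (Fin n → ℂ)) ≤ Submodule.span ℂ (Set.range (jacobianAt f ξ)) := by
    refine (Submodule.eq_top_of_finrank_eq ?_).ge
    refine le_antisymm (Submodule.finrank_le _) ?_
    rw [Module.finrank_fin_fun]
    refine hrank.trans ?_
    rw [Matrix.rank_eq_finrank_span_row]
    rfl
  intro p hp
  -- The rows of `J_f(ξ)` span `ℂⁿ`, so some combination `q` of the equations has the same gradient
  -- at `ξ` as `p`.
  obtain ⟨c, hc⟩ := (Submodule.mem_span_range_iff_exists_fun ℂ).1
    (hspan (x := fun i => eval ξ (pderiv i p)) trivial)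
  let q := ∑ k, C (c k) * map (algebraMap K ℂ) (f k)
  have hq : q ∈ systemIdeal f :=
    Ideal.sum_mem _ fun k _ => Ideal.mul_mem_left _ _ (Ideal.subset_span ⟨k, rfl⟩)
  have hpq : p - q ∈ pointIdeal ξ ^ 2 := by
    refine mem_pointIdeal_sq ?_ fun i => ?_
    · exact sub_mem (S := Ideal _) hp (isRoot_iff_systemIdeal_le.1 hroot hq)
    · have := congr($hc i)
      simp only [Finset.sum_apply, Pi.smul_apply, smul_eq_mul, jacobianAt_apply] at this
      rw [map_sub, map_sub, ← this, map_sum, map_sum, sub_eq_zero]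
      refine Finset.sum_congr rfl fun k _ => ?_
      simp
  exact Submodule.mem_sup.2 ⟨q, hq, p - q, hpq, by ring⟩

/-- Nakayama's lemma in the local ring at `ξ`: generating the maximal ideal modulo its square is
generating it. -/
lemma primaryComponent_eq_pointIdeal {I : Ideal (MvPolynomial (Fin n) ℂ)} {ξ : Fin n → ℂ}
    (hI : I ≤ pointIdeal ξ) (h : pointIdeal ξ ≤ I ⊔ pointIdeal ξ ^ 2) :
    primaryComponent I ξ = pointIdeal ξ := by
  set R := Localization.AtPrime (pointIdeal ξ)
  have hmax := Localization.AtPrime.map_eq_maximalIdeal (I := pointIdeal ξ)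
  have hmap : I.map (algebraMap _ R) = (pointIdeal ξ).map (algebraMap _ R) := by
    refine le_antisymm (Ideal.map_mono hI) ?_
    refine Submodule.le_of_le_smul_of_le_jacobson_bot (I := IsLocalRing.maximalIdeal R)
      (IsNoetherian.noetherian _) (IsLocalRing.jacobson_eq_maximalIdeal ⊥ bot_ne_top).ge ?_
    have := Ideal.map_mono (f := algebraMap _ R) h
    rw [Ideal.map_sup, Ideal.map_pow, pow_two] at this
    rw [← hmax]
    exact this
  rw [primaryComponent, hmap, hmax]
  exact Localization.AtPrime.under_maximalIdeal

lemma isSimpleRoot_of_rank {m : ℕ} {f : Fin m → MvPolynomial (Fin n) K} {ξ : Fin n → ℂ}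
    (hroot : IsRoot f ξ) (hrank : n ≤ (jacobianAt f ξ).rank) : IsSimpleRoot f ξ := by
  refine ⟨hroot, ?_⟩
  rw [multiplicity, primaryComponent_eq_pointIdeal (isRoot_iff_systemIdeal_le.1 hroot)
    (pointIdeal_le_sup_sq hroot hrank)]
  have hker : pointIdeal ξ = RingHom.ker (aeval ξ : MvPolynomial (Fin n) ℂ →ₐ[ℂ] ℂ) := by
    ext p
    simp
  rw [hker, (Ideal.quotientKerAlgEquivOfSurjective (f := (aeval ξ : MvPolynomial (Fin n) ℂ →ₐ[ℂ] ℂ))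
    fun a => ⟨C a, by simp⟩).toLinearEquiv.finrank_eq, Module.finrank_self]

/-! ### Derivations and powers of the ideal of a point -/

lemma derivation_mem_pow {R : Type*} [CommRing R] {k : Type*} [CommRing k] [Algebra k R]
    (D : Derivation k R R) (I : Ideal R) (t : ℕ) {p : R} (hp : p ∈ I ^ (t + 1)) : D p ∈ I ^ t := by
  induction t generalizing p with
  | zero => simp
  | succ t ih =>
    rw [pow_succ'] at hp
    refine Submodule.mul_induction_on hp (fun y hy q hq => ?_) fun a b ha hb => by
      rw [map_add]; exact add_mem ha hb
    rw [D.leibniz, smul_eq_mul, smul_eq_mul]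
    refine add_mem ?_ (Ideal.mul_mem_right _ _ hq)
    rw [pow_succ']
    exact Ideal.mul_mem_mul hy (ih hq)

/-- A functional of order `t` composed with a derivation that does not vanish at `ξ` has order
`t + 1`: if it is of order at most `t`, then `φ` is of order at most `t - 1`. -/
lemma apply_eq_zero_of_comp_derivation {ξ : Fin n → ℂ}
    (D : Derivation ℂ (MvPolynomial (Fin n) ℂ) (MvPolynomial (Fin n) ℂ)) {j : Fin n}
    (hD : eval ξ (D (X j)) ≠ 0) {φ : Module.Dual ℂ (MvPolynomial (Fin n) ℂ)} {t : ℕ}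
    (hφ : ∀ p ∈ pointIdeal ξ ^ (t + 1), φ p = 0) (hφD : ∀ p ∈ pointIdeal ξ ^ (t + 1), φ (D p) = 0) :
    ∀ p ∈ pointIdeal ξ ^ t, φ p = 0 := by
  set y : MvPolynomial (Fin n) ℂ := X j - C (ξ j)
  have hy : y ∈ pointIdeal ξ := by simp [y, RingHom.mem_ker]
  have hDy : D y = D (X j) := by simp [y, ← algebraMap_eq]
  set u := D y
  set u₀ := eval ξ u
  have hu₀ : u₀ ≠ 0 := by simpa only [u₀, hDy] using hD
  have hu : u - C u₀ ∈ pointIdeal ξ := by simp [RingHom.mem_ker, u₀]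
  -- Expanding `φ (D (y ^ (a + 1) * q)) = 0` leaves `φ (y ^ (a + 1) * D q) + (a + 1) * u₀ * φ (y ^ a
  -- * q)`, because `φ` kills the error from replacing `u` by `u₀`. The first term is the case `(a +
  -- 1, b - 1)`, so induction on `b` trades factors of `q` for powers of `y`; at `b = 0` it vanishes
  -- since `y ^ (t + 1)` lies in `𝔪_ξ ^ (t + 1)`.
  suffices ∀ b a, a + b = t → ∀ q ∈ pointIdeal ξ ^ b, φ (y ^ a * q) = 0 by
    intro p hp
    simpa using this t 0 (zero_add t) p hp
  have key : ∀ a b q, a + b = t → q ∈ pointIdeal ξ ^ b → φ (y ^ (a + 1) * D q) = 0 →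
      φ (y ^ a * q) = 0 := by
    intro a b q hab hq hDq
    have hyq : y ^ a * q ∈ pointIdeal ξ ^ t := by
      rw [← hab, pow_add]
      exact Ideal.mul_mem_mul (Ideal.pow_mem_pow hy a) hq
    have h1 : y * (y ^ a * q) ∈ pointIdeal ξ ^ (t + 1) := by
      rw [pow_succ']
      exact Ideal.mul_mem_mul hy hyq
    have h2 : (u - C u₀) * (y ^ a * q) ∈ pointIdeal ξ ^ (t + 1) := by
      rw [pow_succ']
      exact Ideal.mul_mem_mul hu hyq
    have h3 : D (y * (y ^ a * q)) = y ^ (a + 1) * D q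
        + ((a + 1 : ℕ) : ℂ) • ((u - C u₀) * (y ^ a * q) + u₀ • (y ^ a * q)) := by
      rw [← mul_assoc, ← pow_succ', D.leibniz, D.leibniz_pow]
      simp only [smul_eq_mul, nsmul_eq_mul, smul_eq_C_mul, add_tsub_cancel_right, map_natCast]
      change _ + q * (_ * (_ * u)) = _
      ring
    have h4 := hφD _ h1
    rw [h3, map_add, hDq, map_smul, map_add, hφ _ h2, map_smul, zero_add, zero_add, smul_eq_mul,
      smul_eq_mul] at h4
    simpa [hu₀, Nat.cast_add_one_ne_zero] using h4
  intro b
  induction b with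
  | zero =>
    refine fun a hab q hq => key a 0 q hab hq (hφ _ (Ideal.mul_mem_right _ _ ?_))
    rw [← hab]
    exact Ideal.pow_mem_pow hy _
  | succ b ih =>
    exact fun a hab q hq => key a _ q hab hq (ih (a + 1) (by omega) _ (derivation_mem_pow D _ b hq))

/-! ### One deflation step -/

namespace BlockForm

variable {f : ι → MvPolynomial (Fin n) K} {ξ : Fin n → ℂ} (S : BlockForm f ξ)

/-- The operator `Λ_i^x` as a derivation of `ℂ[x]`. -/
noncomputable def derivation (i : Fin S.c) :
    Derivation ℂ (MvPolynomial (Fin n) ℂ) (MvPolynomial (Fin n) ℂ) :=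
  ∑ j, map (algebraMap K ℂ) (S.coeff i j) • pderiv j

lemma derivation_apply (i : Fin S.c) (p : MvPolynomial (Fin n) ℂ) :
    S.derivation i p = ∑ j, map (algebraMap K ℂ) (S.coeff i j) * pderiv j p := by
  rw [derivation, ← Derivation.coeFnAddMonoidHom_apply, map_sum, Finset.sum_apply]
  rfl

lemma derivation_map (i : Fin S.c) (p : MvPolynomial (Fin n) K) :
    S.derivation i (map (algebraMap K ℂ) p) = map (algebraMap K ℂ) (S.op i p) := by
  simp [derivation_apply, op, pderiv_map]

lemma aeval_det_A : aeval ξ S.A.det ≠ 0 := by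
  have := S.det_ne_zero
  rwa [AlgHom.map_det]

/-- The identity block contributes the coefficient `det A` in this column. -/
lemma eval_derivation_X (i : Fin S.c) : eval ξ (S.derivation i (X (S.col (Sum.inr i)))) ≠ 0 := by
  simp only [derivation_apply, pderiv_X, Pi.single_apply, mul_ite, mul_one, mul_zero,
    Finset.sum_ite_eq, Finset.mem_univ, if_true]
  rw [← aeval_eq_eval_map]
  simpa [coeff] using S.aeval_det_A

/-- `Λ_i^x` kills the equations of the rows of the block `[A B]`. -/
lemma op_row (i : Fin S.c) (k : Fin S.r) : S.op i (f (S.row k)) = 0 := by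
  rw [op, ← S.col.sum_comp, Fintype.sum_sum_type]
  -- Cramer's rule: `A * adj A = det A • 1` makes the `A` columns cancel the `B` column.
  have h := congr(($(S.A.mul_adjugate) * S.B) k i)
  rw [Matrix.mul_assoc, Matrix.mul_apply] at h
  simp only [coeff, Equiv.symm_apply_apply, Sum.elim_inl, Sum.elim_inr, ite_mul, zero_mul,
    Finset.sum_ite_eq', Finset.mem_univ, if_true, neg_mul, Finset.sum_neg_distrib]
  rw [neg_add_eq_zero]
  have hB : pderiv (S.col (Sum.inr i)) (f (S.row k)) = S.B k i := rfl
  rw [hB]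
  simp only [Matrix.smul_mul, Matrix.one_mul, Matrix.smul_apply, smul_eq_mul] at h
  rw [← h]
  exact Finset.sum_congr rfl fun l _ => mul_comm _ _

/-- The vector of the values at `ξ` of the coefficients of `Λ_i^x`. -/
noncomputable def direction (i : Fin S.c) : Fin n → ℂ := fun j => aeval ξ (S.coeff i j)

lemma aeval_op (i : Fin S.c) (k : ι) :
    aeval ξ (S.op i (f k)) = (jacobianAt f ξ).mulVec (S.direction i) k := by
  simp only [op, map_sum, map_mul, Matrix.mulVec, dotProduct, direction]
  exact Finset.sum_congr rfl fun j _ => mul_comm _ _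

/-- The selected rows already have the full rank `r`, so they have the same kernel as `J_f(ξ)`; the
direction of `Λ_i^x` lies in that kernel by `op_row`. -/
lemma aeval_op_eq_zero (i : Fin S.c) (k : ι) : aeval ξ (S.op i (f k)) = 0 := by
  set J := jacobianAt f ξ
  set R := J.submatrix S.row id
  have hrank : J.rank ≤ R.rank := by
    rw [S.rank_eq]
    have h1 := Matrix.rank_submatrix_le R id fun k => S.col (Sum.inl k)
    have h2 := Matrix.rank_of_isUnit (R.submatrix id fun k => S.col (Sum.inl k))
      ((Matrix.isUnit_iff_isUnit_det _).2 (isUnit_iff_ne_zero.2 S.det_ne_zero))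
    rw [h2, Fintype.card_fin] at h1
    exact h1
  have hle : LinearMap.ker J.mulVecLin ≤ LinearMap.ker R.mulVecLin := by
    intro v hv
    ext k
    exact congr($hv (S.row k))
  have hker : LinearMap.ker J.mulVecLin = LinearMap.ker R.mulVecLin := by
    refine Submodule.eq_of_le_of_finrank_le hle ?_
    have h1 := J.mulVecLin.finrank_range_add_finrank_ker
    have h2 := R.mulVecLin.finrank_range_add_finrank_ker
    simp only [Matrix.rank] at hrank
    omega
  have hR : S.direction i ∈ LinearMap.ker R.mulVecLin := by
    ext l
    have := S.aeval_op i (S.row l)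
    rw [S.op_row, map_zero] at this
    exact this.symm
  rw [← hker] at hR
  rw [S.aeval_op]
  exact congr($hR k)

end BlockForm

lemma IsDeflatedSystem.isRoot {f : ι → MvPolynomial (Fin n) K} {g : κ → MvPolynomial (Fin n) K}
    {ξ : Fin n → ℂ} (h : IsDeflatedSystem ξ f g) (hf : IsRoot f ξ) : IsRoot g ξ := by
  obtain ⟨S, s, -, e, he⟩ := h
  intro k
  rw [he]
  rcases e k with j | q
  · exact hf j
  · exact S.aeval_op_eq_zero _ _

/-- A functional of order `t` that vanishes on the ideal of a deflated system yields one of order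
`t + 1` that vanishes on the ideal of the original system. -/
lemma IsDeflatedSystem.exists_order_succ {f : ι → MvPolynomial (Fin n) K}
    {g : κ → MvPolynomial (Fin n) K} {ξ : Fin n → ℂ} (h : IsDeflatedSystem ξ f g) {t : ℕ}
    {φ : Module.Dual ℂ (MvPolynomial (Fin n) ℂ)} (hI : ∀ p ∈ systemIdeal g, φ p = 0)
    (hφ : ∀ p ∈ pointIdeal ξ ^ (t + 1), φ p = 0) (hφ' : ¬ ∀ p ∈ pointIdeal ξ ^ t, φ p = 0) :
    ∃ ψ : Module.Dual ℂ (MvPolynomial (Fin n) ℂ), (∀ p ∈ systemIdeal f, ψ p = 0) ∧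
      (∀ p ∈ pointIdeal ξ ^ (t + 2), ψ p = 0) ∧ ¬ ∀ p ∈ pointIdeal ξ ^ (t + 1), ψ p = 0 := by
  obtain ⟨S, s, ⟨i, hi⟩, e, he⟩ := h
  have hfg : ∀ j, map (algebraMap K ℂ) (f j) ∈ systemIdeal g := fun j =>
    Ideal.subset_span ⟨e.symm (Sum.inl j), by simp [he]⟩
  have hDg : ∀ j, S.derivation i (map (algebraMap K ℂ) (f j)) ∈ systemIdeal g := fun j =>
    Ideal.subset_span ⟨e.symm (Sum.inr (⟨i, hi⟩, j)), by simp [he, S.derivation_map]⟩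
  refine ⟨φ ∘ₗ (S.derivation i).toLinearMap, fun p hp => hI _ ?_,
    fun p hp => hφ _ (derivation_mem_pow _ _ _ hp), fun hψ =>
      hφ' (apply_eq_zero_of_comp_derivation _ (S.eval_derivation_X i) hφ hψ)⟩
  change S.derivation i p ∈ _
  have hle : systemIdeal f ≤ systemIdeal g :=
    Ideal.span_le.2 (Set.range_subset_iff.2 hfg)
  -- In `D (a * b) = a * D b + b * D a` the second term is in `systemIdeal g` only because `g`
  -- retains the equations of `f`.
  refine Submodule.span_induction (p := fun q _ => S.derivation i q ∈ systemIdeal g)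
    ?_ (by simp) (fun a b _ _ ha hb => by rw [map_add]; exact add_mem ha hb)
    (fun a b hb hDb => ?_) hp
  · rintro _ ⟨j, rfl⟩
    exact hDg j
  · rw [smul_eq_mul, Derivation.leibniz]
    exact add_mem (Ideal.mul_mem_left _ _ hDb) (Ideal.mul_mem_right _ _ (hle hb))

/-- After `k` deflations, the original system has a functional of order `k` in its inverse
system. -/
lemma exists_order_of_deflations {ξ : Fin n → ℂ} {N : ℕ → ℕ}
    {F : (k : ℕ) → Fin (N k) → MvPolynomial (Fin n) K} (k : ℕ)
    (h : ∀ j < k, IsDeflatedSystem ξ (F j) (F (j + 1))) (hroot : IsRoot (F k) ξ) :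
    ∃ φ : Module.Dual ℂ (MvPolynomial (Fin n) ℂ), (∀ p ∈ systemIdeal (F 0), φ p = 0) ∧
      (∀ p ∈ pointIdeal ξ ^ (k + 1), φ p = 0) ∧ ¬ ∀ p ∈ pointIdeal ξ ^ k, φ p = 0 := by
  -- The induction runs backwards from `F k`: after `t` pullbacks the functional has order `t` and
  -- kills the ideal of `F (k - t)`. It starts from evaluation at `ξ`, of order `0`.
  suffices ∀ t ≤ k, ∃ φ : Module.Dual ℂ (MvPolynomial (Fin n) ℂ),
      (∀ p ∈ systemIdeal (F (k - t)), φ p = 0) ∧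
      (∀ p ∈ pointIdeal ξ ^ (t + 1), φ p = 0) ∧ ¬ ∀ p ∈ pointIdeal ξ ^ t, φ p = 0 by
    have h := this k le_rfl
    rwa [Nat.sub_self] at h
  intro t
  induction t with
  | zero =>
    refine fun _ => ⟨(aeval ξ : MvPolynomial (Fin n) ℂ →ₐ[ℂ] ℂ).toLinearMap, fun p hp => ?_,
      fun p hp => ?_, fun h => ?_⟩
    · have : eval ξ p = 0 := isRoot_iff_systemIdeal_le.1 hroot hp
      simpa [coe_aeval_eq_eval] using this
    · rw [zero_add, pow_one] at hp
      have : eval ξ p = 0 := hp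
      simpa [coe_aeval_eq_eval] using this
    · simpa using h 1 (by simp)
  | succ t ih =>
    intro ht
    obtain ⟨φ, hI, hφ, hφ'⟩ := ih (by omega)
    have hstep := h (k - (t + 1)) (by omega)
    rw [show k - (t + 1) + 1 = k - t by omega] at hstep
    exact hstep.exists_order_succ hI hφ hφ'

end Deflation

theorem mainTheorem5 {n : ℕ} {K : Type*} [Field K] [Algebra K ℂ] (ξ : Fin n → ℂ)
    (N : ℕ → ℕ) (F : (k : ℕ) → Fin (N k) → MvPolynomial (Fin n) K)
    (hξ : Deflation.IsIsolatedRoot (F 0) ξ)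
    (hF : Deflation.IsDeflationSequence ξ N F) :
    ∃ k ≤ Deflation.nilIndex (F 0) ξ,
      (∀ j < k, Deflation.IsDeflatedSystem ξ (F j) (F (j + 1))) ∧
        Deflation.IsSimpleRoot (F k) ξ := by
  have hroot : ∀ k, (∀ j < k, Deflation.IsDeflatedSystem ξ (F j) (F (j + 1))) →
      Deflation.IsRoot (F k) ξ := by
    intro k
    induction k with
    | zero => exact fun _ => hξ.1
    | succ k ih => exact fun h => (h k k.lt_succ_self).isRoot (ih fun j hj => h j (by omega))
  have hex : ∃ k, k ≤ Deflation.nilIndex (F 0) ξ ∧ n ≤ (Deflation.jacobianAt (F k) ξ).rank := by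
    by_contra! hlt
    -- Rank deficiency at every index up to and including the nil-index permits one deflation more
    -- than the nil-index, hence a functional of too large an order.
    have hdefl : ∀ j < Deflation.nilIndex (F 0) ξ + 1,
        Deflation.IsDeflatedSystem ξ (F j) (F (j + 1)) :=
      fun j hj => hF j (hlt j (Nat.le_of_lt_succ hj))
    obtain ⟨φ, hI, hφ, hφ'⟩ := Deflation.exists_order_of_deflations _ hdefl (hroot _ hdefl)
    exact hφ' (hξ.apply_eq_zero (Nat.lt_succ_self _) hI hφ)
  classical
  -- The least index is needed: only while the rank is deficient is the next system known to be a
  -- deflation.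
  have hdefl : ∀ j < Nat.find hex, Deflation.IsDeflatedSystem ξ (F j) (F (j + 1)) := by
    intro j hj
    refine hF j (not_le.1 fun h => Nat.find_min hex hj ⟨?_, h⟩)
    exact hj.le.trans (Nat.find_spec hex).1
  exact ⟨Nat.find hex, (Nat.find_spec hex).1, hdefl,
    Deflation.isSimpleRoot_of_rank (hroot _ hdefl) (Nat.find_spec hex).2⟩
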